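/- Let $K$ be a field and let $A \in \mathbb{Z}^{d \times n}$ be a configuration, i.e. an integer matrix whose columns $\mathbf{a}_1, \dots, \mathbf{a}_n$ lie on a hyperplane of $\mathbb{R}^d$ not passing through the origin; assume that the columns are pairwise distinct. Let $K[A]$ be the $K$-subalgebra of the Laurent polynomial ring $K[t_1^{\pm 1}, \dots, t_d^{\pm 1}]$ generated by the Laurent monomials $T^{\mathbf{a}_1}, \dots, T^{\mathbf{a}_n}$, and let the toric ideal $I_A \subset K[X] = K[x_1, \dots, x_n]$ be the kernel of the $K$-algebra homomorphism $\pi : K[X] \to K[A]$, $\pi(x_j) = T^{\mathbf{a}_j}$. For $\mathbf{u} \in \mathbb{Z}^n$ write $\mathbf{u} = \mathbf{u}^+ - \mathbf{u}^-$ with $\mathbf{u}^+, \mathbf{u}^- \in \mathbb{Z}_{\ge 0}^n$ the positive and negative parts of $\mathbf{u}$. Suppose that $I_A$ is generated by two binomials $f_1 = X^{\mathbf{u}^+} - X^{\mathbf{u}^-}$ and $f_2 = X^{\mathbf{v}^+} - X^{\mathbf{v}^-}$, where $\mathbf{u}, \mathbf{v} \in \mathbb{Z}^n$ are nonzero, such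 that the four monomials $X^{\mathbf{u}^+}$, $X^{\mathbf{u}^-}$, $X^{\mathbf{v}^+}$, $X^{\mathbf{v}^-}$ are squarefree. Then there exists a monomial order on $K[X]$ such that $\{f_1, f_2\}$ is a Gröbner basis of $I_A$, and $K[A]$ is normal, i.e. integrally closed in its field of fractions. -/

import Mathlib

namespace ToricIdeal

noncomputable section

/-- The matrix `A ∈ ℤ^{d × n}` is a configuration of `ℝ^d`: its columns lie on a common
hyperplane `{x | w · x = c}` (with `w ≠ 0`) that does not pass through the origin (`c ≠ 0`). -/
def IsConfiguration {d n : ℕ} (A : Matrix (Fin d) (Fin n) ℤ) : Prop :=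
  ∃ (w : Fin d → ℝ) (c : ℝ), w ≠ 0 ∧ c ≠ 0 ∧ ∀ j, ∑ i, w i * (A i j : ℝ) = c

/-- The Laurent polynomial ring `K[t₁, t₁⁻¹, …, t_d, t_d⁻¹]`: the group algebra over `K` of the
lattice `ℤ^d` of exponent vectors. -/
abbrev LaurentRing (K : Type*) [Field K] (d : ℕ) : Type _ :=
  AddMonoidAlgebra K (Fin d → ℤ)

/-- The Laurent monomial `T^a`. -/
def laurentMonomial (K : Type*) [Field K] {d : ℕ} (a : Fin d → ℤ) : LaurentRing K d :=
  AddMonoidAlgebra.single a 1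

/-- The toric ring `K[A]`: the subalgebra of the Laurent polynomial ring generated by the Laurent
monomials whose exponents are the columns of `A`. -/
def toricRing (K : Type*) [Field K] {d n : ℕ} (A : Matrix (Fin d) (Fin n) ℤ) :
    Subalgebra K (LaurentRing K d) :=
  Algebra.adjoin K (Set.range fun j : Fin n => laurentMonomial K (fun i => A i j))

/-- The homomorphism `π : K[x₁, …, x_n] → K[A]` that sends `x_j` to `T^{a_j}`. -/
def toricMap (K : Type*) [Field K] {d n : ℕ} (A : Matrix (Fin d) (Fin n) ℤ) :
    MvPolynomial (Fin n) K →ₐ[K] toricRing K A :=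
  MvPolynomial.aeval fun j =>
    (⟨laurentMonomial K (fun i => A i j), Algebra.subset_adjoin (Set.mem_range_self j)⟩ :
      toricRing K A)

/-- The toric ideal `I_A = ker π`. -/
def toricIdeal (K : Type*) [Field K] {d n : ℕ} (A : Matrix (Fin d) (Fin n) ℤ) :
    Ideal (MvPolynomial (Fin n) K) :=
  RingHom.ker (toricMap K A)

/-- The positive part `u⁺` of `u ∈ ℤ^n`, as an exponent vector. -/
def posExp {n : ℕ} (u : Fin n → ℤ) : Fin n →₀ ℕ :=
  Finsupp.equivFunOnFinite.symm fun i => (u i).toNat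

/-- The negative part `u⁻` of `u ∈ ℤ^n`, as an exponent vector. -/
def negExp {n : ℕ} (u : Fin n → ℤ) : Fin n →₀ ℕ :=
  Finsupp.equivFunOnFinite.symm fun i => (-u i).toNat

/-- The monomial `X^e`. -/
def mon (K : Type*) [Field K] {n : ℕ} (e : Fin n →₀ ℕ) : MvPolynomial (Fin n) K :=
  MvPolynomial.monomial e 1

/-- The binomial `X^{u⁺} - X^{u⁻}`. -/
def binomial (K : Type*) [Field K] {n : ℕ} (u : Fin n → ℤ) : MvPolynomial (Fin n) K :=
  mon K (posExp u) - mon K (negExp u)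

/-- The ideal generated by the initial monomials of the nonzero elements of `S`. -/
def initialIdeal {K : Type*} [Field K] {n : ℕ} (m : MonomialOrder (Fin n))
    (S : Set (MvPolynomial (Fin n) K)) : Ideal (MvPolynomial (Fin n) K) :=
  Ideal.span ((fun f => mon K (m.degree f)) '' {f | f ∈ S ∧ f ≠ 0})

/-- `G` is a Gröbner basis of `I` with respect to `m`: a finite set of nonzero elements of `I`
whose initial monomials generate the initial ideal of `I`. -/
def IsGroebnerBasis {K : Type*} [Field K] {n : ℕ} (m : MonomialOrder (Fin n))
    (I : Ideal (MvPolynomial (Fin n) K)) (G : Set (MvPolynomial (Fin n) K)) : Prop :=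
  G.Finite ∧ 0 ∉ G ∧ G ⊆ I ∧ initialIdeal m G = initialIdeal m I

end

end ToricIdeal

/-! Squarefreeness means `u` and `v` have entries in {-1, 0, 1}, and the integer kernel of `A` is ℤu
+ ℤv. If `u` and `v` shared both a positive and a negative coordinate, `I_A` would lie in an ideal
(x_i, x_j) that misses the binomial of `u - v` (`not_mixed`). The same holds for `u` and `-v`, so
when v ≠ ±u one of the four monomials is disjoint from the other binomial
(`exists_disjoint_support`). Up to signs and a swap, it is X^{u⁺}.

Gröbner basis: a lex order headed by a variable of X^{u⁺} makes the initial monomials coprime.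

Normality: an exponent of an element integral over K[A] satisfies every linear inequality valid on
the columns (`nonneg_of_isIntegral`). Eliminating first `u`, then `v`, involves only coefficients in
{-1, 0, 1}, so Fourier–Motzkin works over ℤ (`exists_nonneg_add`) and the exponent is a nonnegative
integer combination of columns. -/

/-! ### Integrality in Laurent polynomial rings. -/

open Polynomial LaurentPolynomial in
theorem LaurentPolynomial.isIntegrallyClosed (R : Type*) [CommRing R] [IsDomain R]
    [IsIntegrallyClosed R] : IsIntegrallyClosed R[T;T⁻¹] :=
  isIntegrallyClosed_of_isLocalization (R := R[X]) _ (Submonoid.powers X)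
    (powers_le_nonZeroDivisors_of_noZeroDivisors X_ne_zero)

-- The Laurent ring embeds in the fraction field of `R[X]`, and `R[X]` is integrally closed.
open Polynomial LaurentPolynomial in
theorem LaurentPolynomial.exists_toLaurent_eq_of_isIntegral {R : Type*} [CommRing R] [IsDomain R]
    [IsIntegrallyClosed R] {f : R[T;T⁻¹]} (hf : IsIntegral R[X] f) :
    ∃ p : R[X], toLaurent p = f := by
  let F := FractionRing R[X]
  have hX : Submonoid.powers (X : R[X]) ≤ nonZeroDivisors R[X] :=
    powers_le_nonZeroDivisors_of_noZeroDivisors X_ne_zero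
  let g : R[T;T⁻¹] →+* F := IsLocalization.lift (M := Submonoid.powers (X : R[X]))
    (g := algebraMap R[X] F) fun y => IsLocalization.map_units F (⟨y, hX y.2⟩ : nonZeroDivisors R[X])
  have hg : ∀ p : R[X], g (toLaurent p) = algebraMap R[X] F p := fun p =>
    IsLocalization.lift_eq _ p
  have hinj : Function.Injective g := by
    refine (IsLocalization.lift_injective_iff _).2 fun x y => ?_
    rw [(IsFractionRing.injective R[X] F).eq_iff, algebraMap_eq_toLaurent, algebraMap_eq_toLaurent,
      toLaurent_inj]
  have hint : IsIntegral R[X] (g f) := by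
    obtain ⟨p, hp, hpf⟩ := hf
    refine ⟨p, hp, ?_⟩
    rw [show algebraMap R[X] F = g.comp (algebraMap R[X] R[T;T⁻¹]) from
      RingHom.ext fun p => (hg p).symm, ← hom_eval₂, hpf, map_zero]
  obtain ⟨p, hp⟩ := IsIntegrallyClosed.isIntegral_iff.1 hint
  exact ⟨p, hinj ((hg p).trans hp)⟩

namespace ToricIdeal

theorem isIntegrallyClosed_laurentRing (K : Type*) [Field K] (r : ℕ) :
    IsIntegrallyClosed (LaurentRing K r) := by
  induction r with
  | zero =>
    exact IsIntegrallyClosed.of_equiv (AddMonoidAlgebra.uniqueRingEquiv (R := K) (Fin 0 → ℤ)).symm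
  | succ r ih =>
    let e : (ℤ × (Fin r → ℤ)) ≃+ (Fin (r + 1) → ℤ) :=
      { Fin.consEquiv (fun _ => ℤ) with
        map_add' := fun a b => by
          funext i
          refine Fin.cases ?_ (fun i => ?_) i <;> simp [Fin.consEquiv] }
    have : IsIntegrallyClosed (LaurentPolynomial (LaurentRing K r)) :=
      LaurentPolynomial.isIntegrallyClosed _
    exact IsIntegrallyClosed.of_equiv (((AddMonoidAlgebra.curryRingEquiv (R := K) (M := ℤ)
      (N := Fin r → ℤ)).symm.trans (AddMonoidAlgebra.mapDomainRingEquiv K e)))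

/-- Nonnegativity of a weight on supports is inherited by integral elements. -/
theorem nonneg_of_isIntegral {K : Type*} [Field K] {r : ℕ} (R : Subalgebra K (LaurentRing K r))
    (l : (Fin r → ℤ) →+ ℤ) (hR : ∀ g ∈ R, ∀ a ∈ g.coeff.support, 0 ≤ l a)
    {f : LaurentRing K r} (hf : IsIntegral R f) : ∀ a ∈ f.coeff.support, 0 ≤ l a := by
  have := isIntegrallyClosed_laurentRing K r
  -- `φ` records the weight in a new variable `T`, sending the monomial of exponent `a` to `T^(l a)`
  -- times itself. Elements of `R` become polynomials in `T`, so integrality forces `φ f` to be one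
  -- too.
  let j : (Fin r → ℤ) →+ ℤ × (Fin r → ℤ) := l.prod (AddMonoidHom.id _)
  let φ : LaurentRing K r →+* LaurentPolynomial (LaurentRing K r) :=
    (AddMonoidAlgebra.curryRingEquiv (R := K) (M := ℤ) (N := Fin r → ℤ)).toRingHom.comp
      (AddMonoidAlgebra.mapDomainRingHom K j)
  have hφs : ∀ a c, φ (AddMonoidAlgebra.single a c) =
      AddMonoidAlgebra.single (l a) (AddMonoidAlgebra.single a c) := by
    intro a c
    simp [φ, j]
  have hφc : ∀ (g : LaurentRing K r) (a), ((φ g).coeff (l a)).coeff a = g.coeff a := by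
    intro g a
    induction g using AddMonoidAlgebra.induction_linear with
    | zero => simp
    | add f g hf hg => simp [hf, hg]
    | single b c =>
      rw [hφs]
      rw [AddMonoidAlgebra.coeff_single, AddMonoidAlgebra.coeff_single]
      by_cases hb : b = a
      · simp [hb]
      · by_cases hl : l b = l a <;> simp [hl, hb]
  have hmem : ∀ g ∈ R, φ g ∈ (Polynomial.toLaurent (R := LaurentRing K r)).range := by
    intro g hg
    rw [← AddMonoidAlgebra.sum_coeff_single g, Finsupp.sum, map_sum]
    refine sum_mem fun a ha => ?_
    obtain ⟨k, hk⟩ := Int.eq_ofNat_of_zero_le (hR g hg a ha)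
    rw [hφs, hk]
    refine ⟨Polynomial.C (AddMonoidAlgebra.single a (g.coeff a)) * Polynomial.X ^ k, ?_⟩
    rw [Polynomial.toLaurent_C_mul_X_pow, LaurentPolynomial.single_eq_C_mul_T]
  obtain ⟨p, hp, hpf⟩ := hf
  obtain ⟨q, hq, -, hqm⟩ := Polynomial.lifts_and_natDegree_eq_and_monic
    (f := (Polynomial.toLaurent (R := LaurentRing K r)))
    (p := p.map (φ.comp (algebraMap R (LaurentRing K r))))
    (by
      rw [Polynomial.lifts_iff_coeff_lifts]
      intro k
      rw [Polynomial.coeff_map]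
      exact hmem _ (p.coeff k).2) (hp.map _)
  have hint : IsIntegral (Polynomial (LaurentRing K r)) (φ f) := by
    refine ⟨q, hqm, ?_⟩
    change Polynomial.eval₂ Polynomial.toLaurent (φ f) q = 0
    rw [← Polynomial.eval_map, hq, Polynomial.eval_map, ← Polynomial.hom_eval₂, hpf, map_zero]
  obtain ⟨P, hP⟩ := LaurentPolynomial.exists_toLaurent_eq_of_isIntegral hint
  intro a ha
  by_contra hneg
  rw [Finsupp.mem_support_iff, ← hφc, ← hP] at ha
  refine ha ?_
  have : l a ∉ (Polynomial.toLaurent P).coeff.support := by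
    rw [LaurentPolynomial.support_coeff_toLaurent]
    intro h
    obtain ⟨k, -, hk⟩ := Finset.mem_map.1 h
    rw [← hk] at hneg
    exact hneg (Int.natCast_nonneg k)
  rw [Finsupp.notMem_support_iff.1 this]
  rfl

end ToricIdeal

/-! ### Integer Fourier–Motzkin elimination. -/

namespace ToricIdeal

theorem exists_int_between {L U : Set ℤ} (hL : L.Finite) (hU : U.Finite)
    (h : ∀ l ∈ L, ∀ u ∈ U, l ≤ u) : ∃ k, (∀ l ∈ L, l ≤ k) ∧ ∀ u ∈ U, k ≤ u := by
  rcases L.eq_empty_or_nonempty with rfl | hne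
  · obtain ⟨k, hk⟩ := hU.bddBelow
    exact ⟨k, by simp, fun u hu => hk hu⟩
  · obtain ⟨k, hk, hmax⟩ := L.exists_max_image id hL hne
    exact ⟨k, hmax, h k hk⟩

/-- One step of Fourier–Motzkin elimination over the integers, for functionals that take only
the values `-1`, `0`, `1` on the eliminated direction. -/
theorem exists_add_zsmul_nonneg {G : Type*} [AddCommGroup G] {F : Set (G →+ ℤ)} (hF : F.Finite)
    (u w : G) (hu : ∀ l ∈ F, l u = -1 ∨ l u = 0 ∨ l u = 1)
    (h0 : ∀ l ∈ F, l u = 0 → 0 ≤ l w)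
    (h1 : ∀ l ∈ F, ∀ l' ∈ F, l u = 1 → l' u = -1 → 0 ≤ (l + l') w) :
    ∃ k : ℤ, ∀ l ∈ F, 0 ≤ l (w + k • u) := by
  -- As `l u = ±1`, each constraint bounds `k` by an integer, without division.
  obtain ⟨k, hk, hk'⟩ := exists_int_between
    (L := (fun l : G →+ ℤ => -l w) '' {l ∈ F | l u = 1})
    (U := (fun l : G →+ ℤ => l w) '' {l ∈ F | l u = -1})
    ((hF.sep _).image _) ((hF.sep _).image _) (by
      rintro _ ⟨l, ⟨hl, hlu⟩, rfl⟩ _ ⟨l', ⟨hl', hlu'⟩, rfl⟩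
      have := h1 l hl l' hl' hlu hlu'
      rw [AddMonoidHom.add_apply] at this
      linarith)
  refine ⟨k, fun l hl => ?_⟩
  rw [map_add, map_zsmul, smul_eq_mul]
  rcases hu l hl with h | h | h
  · have := hk' _ ⟨l, ⟨hl, h⟩, rfl⟩
    rw [h]; linarith
  · rw [h, mul_zero, add_zero]; exact h0 l hl h
  · have := hk _ ⟨l, ⟨hl, h⟩, rfl⟩
    rw [h]; linarith

/-- A Farkas lemma over the integers for the lattice spanned by `u` and `v`. -/
theorem exists_nonneg_add {n : ℕ} {u v : Fin n → ℤ}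
    (hu : ∀ i, u i = -1 ∨ u i = 0 ∨ u i = 1) (hv : ∀ i, v i = -1 ∨ v i = 0 ∨ v i = 1)
    (huv : ∀ i, u i = 1 → v i = 0) (w : Fin n → ℤ)
    (hw : ∀ l : (Fin n → ℤ) →+ ℤ, (∀ i, 0 ≤ l (Pi.single i 1)) → l u = 0 → l v = 0 → 0 ≤ l w) :
    ∃ k m : ℤ, 0 ≤ w + k • u + m • v := by
  let F : Set ((Fin n → ℤ) →+ ℤ) := Set.range fun i => Pi.evalAddMonoidHom (fun _ => ℤ) i
  have hF : F.Finite := Set.finite_range _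
  -- The constraints left after eliminating `u` from the coordinate inequalities.
  let F' : Set ((Fin n → ℤ) →+ ℤ) := {l ∈ F | l u = 0} ∪
    Set.image2 (fun l l' => l + l') {l ∈ F | l u = 1} {l ∈ F | l u = -1}
  have hF' : F'.Finite := (hF.sep _).union ((hF.sep _).image2 _ (hF.sep _))
  have hnn : ∀ l ∈ F', ∀ i, 0 ≤ l (Pi.single i 1) := by
    have key : ∀ i j : Fin n, 0 ≤ (Pi.single i 1 : Fin n → ℤ) j := fun i j => by
      rw [Pi.single_apply]; split_ifs <;> norm_num
    rintro _ (⟨⟨j, rfl⟩, -⟩ | ⟨_, ⟨⟨j, rfl⟩, -⟩, _, ⟨⟨j', rfl⟩, -⟩, rfl⟩) i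
    · exact key i j
    · exact add_nonneg (key i j) (key i j')
  have hu0 : ∀ l ∈ F', l u = 0 := by
    rintro _ (⟨-, h⟩ | ⟨l, ⟨-, h⟩, l', ⟨-, h'⟩, rfl⟩)
    · exact h
    · simp [h, h']
  obtain ⟨m, hm⟩ := exists_add_zsmul_nonneg hF' v w (by
      rintro _ (⟨⟨j, rfl⟩, -⟩ | ⟨_, ⟨⟨j, rfl⟩, h⟩, _, ⟨⟨j', rfl⟩, -⟩, rfl⟩)
      · exact hv j
      -- Disjointness keeps the value `v j + v j'` in {-1, 0, 1}; otherwise it could be ±2.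
      · have : v j = 0 := huv j h
        simpa [this] using hv j')
    (fun l hl h => hw l (hnn l hl) (hu0 l hl) h)
    (fun l hl l' hl' h h' => hw _ (fun i => add_nonneg (hnn l hl i) (hnn l' hl' i))
      (by simp [hu0 l hl, hu0 l' hl']) (by simp [h, h']))
  obtain ⟨k, hk⟩ := exists_add_zsmul_nonneg hF u (w + m • v) (by
      rintro _ ⟨j, rfl⟩
      exact hu j)
    (fun l hl h => hm l (Or.inl ⟨hl, h⟩))
    (fun l hl l' hl' h h' => hm _ (Or.inr ⟨l, ⟨hl, h⟩, l', ⟨hl', h'⟩, rfl⟩))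
  refine ⟨k, m, fun i => ?_⟩
  have := hk _ ⟨i, rfl⟩
  rw [add_right_comm]
  exact this

/-! ### Normality of the toric ring. -/

variable {K : Type*} [Field K] {d n : ℕ}

theorem laurentMonomial_add (a b : Fin d → ℤ) :
    laurentMonomial K (a + b) = laurentMonomial K a * laurentMonomial K b := by
  simp [laurentMonomial, AddMonoidAlgebra.single_mul_single]

theorem laurentMonomial_injective :
    Function.Injective (laurentMonomial K : (Fin d → ℤ) → LaurentRing K d) := fun _ _ h =>
  AddMonoidAlgebra.of_injective (R := K) (M := Fin d → ℤ) h

theorem coe_toricMap_mon (A : Matrix (Fin d) (Fin n) ℤ) (e : Fin n →₀ ℕ) :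
    (toricMap K A (mon K e) : LaurentRing K d) =
      laurentMonomial K (A.mulVec fun j => (e j : ℤ)) := by
  induction e using Finsupp.induction_linear with
  | zero =>
    have : (A.mulVec fun j => (((0 : Fin n →₀ ℕ) j : ℕ) : ℤ)) = 0 := by
      rw [← Matrix.mulVec_zero A]; congr 1
    have h1 : mon K (0 : Fin n →₀ ℕ) = 1 := rfl
    rw [this, h1, map_one]
    rfl
  | add f g hf hg =>
    have h1 : mon K (f + g) = mon K f * mon K g := by simp [mon, MvPolynomial.monomial_mul]
    have h2 : (A.mulVec fun j => (((f + g) j : ℕ) : ℤ)) =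
        (A.mulVec fun j => (f j : ℤ)) + A.mulVec fun j => (g j : ℤ) := by
      rw [← Matrix.mulVec_add]; congr 1
    rw [h1, h2, map_mul, laurentMonomial_add, ← hf, ← hg, MulMemClass.coe_mul]
  | single j k =>
    have h1 : mon K (Finsupp.single j k) = MvPolynomial.X j ^ k := by
      rw [MvPolynomial.X_pow_eq_monomial]; rfl
    have h2 : (A.mulVec fun i => ((Finsupp.single j k i : ℕ) : ℤ)) = k • fun i => A i j := by
      ext i
      simp [Matrix.mulVec, dotProduct, Finsupp.single_apply, mul_comm]
    rw [h1, h2, map_pow, toricMap, MvPolynomial.aeval_X]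
    simp [laurentMonomial, AddMonoidAlgebra.single_pow]

theorem laurentMonomial_mulVec_mem (A : Matrix (Fin d) (Fin n) ℤ) {w : Fin n → ℤ} (hw : 0 ≤ w) :
    laurentMonomial K (A.mulVec w) ∈ toricRing K A := by
  have : w = fun j => ((Finsupp.equivFunOnFinite.symm fun i => (w i).toNat) j : ℤ) := by
    ext j
    simpa using (hw j)
  rw [this, ← coe_toricMap_mon]
  exact Subtype.property _

theorem nonneg_of_mem_toricRing (A : Matrix (Fin d) (Fin n) ℤ) (l : (Fin d → ℤ) →+ ℤ)
    (hl : ∀ j, 0 ≤ l fun i => A i j) {g : LaurentRing K d} (hg : g ∈ toricRing K A) :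
    ∀ a ∈ g.coeff.support, 0 ≤ l a := by
  classical
  induction hg using Algebra.adjoin_induction with
  | mem x hx =>
    obtain ⟨j, rfl⟩ := hx
    intro a ha
    have := Finset.mem_singleton.1 (Finsupp.support_single_subset ha)
    rw [this]; exact hl j
  | algebraMap c =>
    intro a ha
    have := Finset.mem_singleton.1 (Finsupp.support_single_subset ha)
    rw [this, map_zero]
  | add x y _ _ hx hy =>
    intro a ha
    rcases Finset.mem_union.1 (Finsupp.support_add ha) with h | h
    exacts [hx a h, hy a h]
  | mul x y _ _ hx hy =>
    intro a ha
    obtain ⟨b, hb, c, hc, rfl⟩ := Finset.mem_add.1 (AddMonoidAlgebra.support_coeff_mul_subset x y ha)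
    rw [map_add]
    exact add_nonneg (hx b hb) (hy c hc)

theorem mem_toricRing_of_isIntegral {A : Matrix (Fin d) (Fin n) ℤ}
    (hA : Function.Surjective A.mulVec) {u v : Fin n → ℤ}
    (hu : ∀ i, u i = -1 ∨ u i = 0 ∨ u i = 1) (hv : ∀ i, v i = -1 ∨ v i = 0 ∨ v i = 1)
    (huv : ∀ i, u i = 1 → v i = 0) (hAu : A.mulVec u = 0) (hAv : A.mulVec v = 0)
    (hker : ∀ w, A.mulVec w = 0 → ∃ k m : ℤ, w = k • u + m • v)
    {f : LaurentRing K d} (hf : IsIntegral (toricRing K A) f) : f ∈ toricRing K A := by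
  rw [← AddMonoidAlgebra.sum_coeff_single f]
  refine sum_mem fun a ha => ?_
  obtain ⟨w, rfl⟩ := hA a
  obtain ⟨k, m, hkm⟩ := exists_nonneg_add hu hv huv w fun l hl hlu hlv => by
    -- A functional killing `u` and `v` kills the kernel of `A`, so it descends to exponents, where
    -- it is nonnegative on the columns.
    let l' : (Fin d → ℤ) →+ ℤ :=
      (QuotientAddGroup.lift A.mulVecLin.toAddMonoidHom.ker l fun x hx => by
        obtain ⟨k, m, rfl⟩ := hker x hx
        rw [AddMonoidHom.mem_ker, map_add, map_zsmul, map_zsmul, hlu, hlv,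
          smul_zero, smul_zero, add_zero]).comp
      (QuotientAddGroup.quotientKerEquivOfSurjective A.mulVecLin.toAddMonoidHom hA).symm.toAddMonoidHom
    have hl' : ∀ x, l' (A.mulVec x) = l x := fun x => by
      have : (QuotientAddGroup.quotientKerEquivOfSurjective A.mulVecLin.toAddMonoidHom hA).symm
          (A.mulVec x) = (x : (Fin n → ℤ) ⧸ A.mulVecLin.toAddMonoidHom.ker) := by
        rw [AddEquiv.symm_apply_eq]; rfl
      simp only [l', AddMonoidHom.comp_apply]
      erw [this]
      rfl
    rw [← hl']
    refine nonneg_of_isIntegral (toricRing K A) l' (fun g hg => nonneg_of_mem_toricRing A l' ?_ hg)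
      hf _ ha
    intro j
    have : (fun i => A i j) = A.mulVec (Pi.single j 1) := by simp; rfl
    rw [this, hl']
    exact hl j
  have : A.mulVec w = A.mulVec (w + k • u + m • v) := by
    rw [Matrix.mulVec_add, Matrix.mulVec_add, Matrix.mulVec_smul, Matrix.mulVec_smul, hAu, hAv,
      smul_zero, smul_zero, add_zero, add_zero]
  rw [this]
  have h := (toricRing K A).smul_mem (laurentMonomial_mulVec_mem (K := K) A hkm)
    (f.coeff (A.mulVec (w + k • u + m • v)))
  simpa [laurentMonomial] using h

/-- The fraction field of `R` embeds in that of `E`, so a fraction integral over `R` already lies in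
`E`. -/
theorem isIntegrallyClosed_of_mem_of_isIntegral {E : Type*} [CommRing E] [IsDomain E]
    [IsIntegrallyClosed E] [Algebra K E] (R : Subalgebra K E)
    (h : ∀ f : E, IsIntegral R f → f ∈ R) : IsIntegrallyClosed R := by
  let ψ : FractionRing R →+* FractionRing E :=
    IsFractionRing.lift (A := R) (g := (algebraMap E (FractionRing E)).comp (algebraMap R E))
      ((IsFractionRing.injective E (FractionRing E)).comp Subtype.val_injective)
  have hψ : ∀ r : R, ψ (algebraMap R _ r) = algebraMap E _ (r : E) := fun r =>
    IsFractionRing.lift_algebraMap _ r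
  have hcomp : ψ.comp (algebraMap R (FractionRing R)) =
      (algebraMap E (FractionRing E)).comp (algebraMap R E) := RingHom.ext hψ
  refine (isIntegrallyClosed_iff (FractionRing R)).2 fun {x} hx => ?_
  obtain ⟨p, hp, hpx⟩ := hx
  have hp0 : p.eval₂ ((algebraMap E (FractionRing E)).comp (algebraMap R E)) (ψ x) = 0 := by
    rw [← hcomp, ← Polynomial.hom_eval₂, hpx, map_zero]
  have hE : IsIntegral E (ψ x) :=
    ⟨p.map (algebraMap R E), hp.map _, by rwa [Polynomial.eval₂_map]⟩
  obtain ⟨f, hf⟩ := IsIntegrallyClosed.isIntegral_iff.1 hE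
  have hfR : f ∈ R := by
    refine h f ⟨p, hp, IsFractionRing.injective E (FractionRing E) ?_⟩
    rw [Polynomial.hom_eval₂, hf, hp0, map_zero]
  exact ⟨⟨f, hfR⟩, ψ.injective (by rw [hψ, hf])⟩

/-- Passing to a basis of the lattice generated by the columns. -/
theorem exists_surjective_toricRing_equiv (K : Type*) [Field K] (A : Matrix (Fin d) (Fin n) ℤ) :
    ∃ (r : ℕ) (B : Matrix (Fin r) (Fin n) ℤ), Function.Surjective B.mulVec ∧
      (∀ w, B.mulVec w = 0 ↔ A.mulVec w = 0) ∧ Nonempty (toricRing K B ≃+* toricRing K A) := by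
  let b := Module.finBasis ℤ (LinearMap.range A.mulVecLin)
  let B := LinearMap.toMatrix' (b.equivFun.toLinearMap ∘ₗ A.mulVecLin.rangeRestrict)
  have hB : ∀ w, B.mulVec w = b.equivFun (A.mulVecLin.rangeRestrict w) := fun w => by
    simp [B, LinearMap.toMatrix'_mulVec]
  let j : (Fin _ → ℤ) →ₗ[ℤ] (Fin d → ℤ) :=
    (LinearMap.range A.mulVecLin).subtype ∘ₗ b.equivFun.symm.toLinearMap
  have hj : Function.Injective j := Subtype.val_injective.comp b.equivFun.symm.injective
  have hjB : ∀ w, j (B.mulVec w) = A.mulVec w := fun w => by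
    simp [hB, j]
  refine ⟨_, B, fun a => ?_, fun w => ?_, ?_⟩
  · obtain ⟨w, hw⟩ := A.mulVecLin.surjective_rangeRestrict (b.equivFun.symm a)
    exact ⟨w, by rw [hB, hw, LinearEquiv.apply_symm_apply]⟩
  · rw [← hjB, map_eq_zero_iff j hj]
  · let φ := AddMonoidAlgebra.mapDomainAlgHom K K j.toAddMonoidHom
    have hφ : Function.Injective φ := AddMonoidAlgebra.mapDomain_injective hj
    have hcol : ∀ (r : ℕ) (C : Matrix (Fin r) (Fin n) ℤ) (k : Fin n),
        (fun i => C i k) = C.mulVec (Pi.single k 1) := fun r C k => by simp; rfl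
    have : (toricRing K B).map φ = toricRing K A := by
      rw [toricRing, AlgHom.map_adjoin, toricRing, ← Set.range_comp]
      congr 2
      funext k
      rw [hcol d A, ← hjB, ← hcol]
      simp [φ, laurentMonomial]
    rw [← this]
    exact ⟨((toricRing K B).equivMapOfInjective φ hφ).toRingEquiv⟩

theorem isIntegrallyClosed_toricRing {A : Matrix (Fin d) (Fin n) ℤ} {u v : Fin n → ℤ}
    (hu : ∀ i, u i = -1 ∨ u i = 0 ∨ u i = 1) (hv : ∀ i, v i = -1 ∨ v i = 0 ∨ v i = 1)
    (huv : ∀ i, u i = 1 → v i = 0) (hAu : A.mulVec u = 0) (hAv : A.mulVec v = 0)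
    (hker : ∀ w, A.mulVec w = 0 → ∃ k m : ℤ, w = k • u + m • v) :
    IsIntegrallyClosed (toricRing K A) := by
  -- An exponent outside the column lattice could be integral over K[A]; for `B` the column lattice
  -- is everything.
  obtain ⟨r, B, hB, hBA, ⟨e⟩⟩ := exists_surjective_toricRing_equiv K A
  have := isIntegrallyClosed_laurentRing K r
  have := isIntegrallyClosed_of_mem_of_isIntegral (toricRing K B) fun f hf =>
    mem_toricRing_of_isIntegral hB hu hv huv ((hBA u).2 hAu) ((hBA v).2 hAv)
      (fun w hw => hker w ((hBA w).1 hw)) hf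
  exact IsIntegrallyClosed.of_equiv e

end ToricIdeal

/-! ### Binomials of the toric ideal and their supports. -/

namespace ToricIdeal

variable {K : Type*} [Field K] {d n : ℕ}

theorem posExp_apply (u : Fin n → ℤ) (i : Fin n) : posExp u i = (u i).toNat := rfl

theorem negExp_apply (u : Fin n → ℤ) (i : Fin n) : negExp u i = (-u i).toNat := rfl

theorem posExp_neg (u : Fin n → ℤ) : posExp (-u) = negExp u := rfl

theorem negExp_neg (u : Fin n → ℤ) : negExp (-u) = posExp u := by
  ext i; simp [posExp_apply, negExp_apply]

theorem binomial_neg (u : Fin n → ℤ) : binomial K (-u) = -binomial K u := by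
  rw [binomial, binomial, posExp_neg, negExp_neg, neg_sub]

theorem le_one_of_squarefree_mon {e : Fin n →₀ ℕ} (he : Squarefree (mon K e)) (i : Fin n) :
    e i ≤ 1 := by
  by_contra h
  have hdvd : (MvPolynomial.X i * MvPolynomial.X i : MvPolynomial (Fin n) K) ∣ mon K e := by
    rw [← sq, MvPolynomial.X_pow_eq_monomial]
    exact (MvPolynomial.monomial_dvd_monomial).2 ⟨Or.inr fun j => by
      by_cases hj : i = j
      · subst hj; simp; omega
      · simp [hj], one_dvd _⟩
  exact (MvPolynomial.X_prime (i := i)).not_isUnit (he _ hdvd)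

theorem eq_of_squarefree {u : Fin n → ℤ} (hp : Squarefree (mon K (posExp u)))
    (hn : Squarefree (mon K (negExp u))) (i : Fin n) : u i = -1 ∨ u i = 0 ∨ u i = 1 := by
  have h1 := le_one_of_squarefree_mon hp i
  have h2 := le_one_of_squarefree_mon hn i
  rw [posExp_apply] at h1
  rw [negExp_apply] at h2
  omega

theorem binomial_mem_toricIdeal {A : Matrix (Fin d) (Fin n) ℤ} {u : Fin n → ℤ} :
    binomial K u ∈ toricIdeal K A ↔ A.mulVec u = 0 := by
  have hu : u = (fun j => (posExp u j : ℤ)) - fun j => (negExp u j : ℤ) := by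
    ext j; simp only [Pi.sub_apply, posExp_apply, negExp_apply]; omega
  rw [toricIdeal, RingHom.mem_ker, binomial, map_sub, sub_eq_zero, Subtype.ext_iff,
    coe_toricMap_mon, coe_toricMap_mon, laurentMonomial_injective.eq_iff]
  conv_rhs => rw [hu, Matrix.mulVec_sub, sub_eq_zero]

theorem posExp_ne_negExp {u : Fin n → ℤ} (hu : u ≠ 0) : posExp u ≠ negExp u := by
  intro h
  refine hu (funext fun i => ?_)
  have := DFunLike.congr_fun h i
  rw [posExp_apply, negExp_apply] at this
  simp only [Pi.zero_apply]; omega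

theorem coeff_mon (e e' : Fin n →₀ ℕ) :
    (mon K e).coeff e' = if e = e' then 1 else 0 := by
  classical
  exact MvPolynomial.coeff_monomial _ _ _

theorem posExp_mem_support {u : Fin n → ℤ} (hu : u ≠ 0) :
    posExp u ∈ (binomial K u).support := by
  rw [MvPolynomial.mem_support_iff, binomial, MvPolynomial.coeff_sub, coeff_mon, coeff_mon,
    if_pos rfl, if_neg (posExp_ne_negExp hu).symm]
  simp

theorem eq_or_eq_of_mem_support {u : Fin n → ℤ} {e : Fin n →₀ ℕ}
    (he : e ∈ (binomial K u).support) : e = posExp u ∨ e = negExp u := by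
  rw [MvPolynomial.mem_support_iff, binomial, MvPolynomial.coeff_sub, coeff_mon, coeff_mon] at he
  by_contra! h
  rw [if_neg h.1.symm, if_neg h.2.symm] at he
  simp at he

theorem binomial_ne_zero {u : Fin n → ℤ} (hu : u ≠ 0) : binomial K u ≠ 0 := fun h => by
  have := posExp_mem_support (K := K) hu
  simp [h] at this

/-- Binomials in `(X^{u⁺} - X^{u⁻}, X^{v⁺} - X^{v⁻})` have exponents in the lattice spanned by
`u` and `v`. -/
theorem exists_zsmul_add_zsmul {u v w : Fin n → ℤ}
    (hw : binomial K w ∈ Ideal.span {binomial K u, binomial K v}) :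
    ∃ k m : ℤ, w = k • u + m • v := by
  let N := AddSubgroup.closure {u, v}
  -- Reading exponents modulo `N` gives a ring map killing exactly those binomials whose exponent
  -- vector lies in `N`.
  let q : (Fin n →₀ ℕ) →+ (Fin n → ℤ) ⧸ N :=
    (QuotientAddGroup.mk' N).comp
      { toFun := fun e j => (e j : ℤ)
        map_zero' := by ext; simp
        map_add' := fun _ _ => by ext; simp }
  let χ : MvPolynomial (Fin n) K →+* AddMonoidAlgebra K ((Fin n → ℤ) ⧸ N) :=
    AddMonoidAlgebra.mapDomainRingHom K q
  have hχ : ∀ e, χ (mon K e) = AddMonoidAlgebra.single (q e) 1 := fun e =>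
    AddMonoidAlgebra.mapDomain_single
  have hχb : ∀ x : Fin n → ℤ, χ (binomial K x) = 0 ↔ x ∈ N := by
    intro x
    have hx : x = -(fun j => (negExp x j : ℤ)) + fun j => (posExp x j : ℤ) := by
      ext j; simp only [Pi.add_apply, Pi.neg_apply, posExp_apply, negExp_apply]; omega
    have hq : χ (binomial K x) = 0 ↔ q (posExp x) = q (negExp x) := by
      rw [binomial, map_sub, sub_eq_zero, hχ, hχ]
      exact (AddMonoidAlgebra.of_injective (R := K) (M := (Fin n → ℤ) ⧸ N)).eq_iff
        (a := Multiplicative.ofAdd (q (posExp x))) (b := Multiplicative.ofAdd (q (negExp x)))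
    rw [hq, eq_comm]
    conv_rhs => rw [hx, ← QuotientAddGroup.eq]
    rfl
  have hle : Ideal.span {binomial K u, binomial K v} ≤ RingHom.ker χ := by
    rw [Ideal.span_le]
    rintro _ (rfl | rfl)
    · exact (hχb u).2 (AddSubgroup.subset_closure (by simp))
    · exact (hχb v).2 (AddSubgroup.subset_closure (by simp))
  obtain ⟨k, m, h⟩ := AddSubgroup.mem_closure_pair.1 ((hχb w).1 (hle hw))
  exact ⟨k, m, h.symm⟩

theorem not_mixed {u v : Fin n → ℤ} (huv : u ≠ v)
    (h : binomial K (u - v) ∈ Ideal.span {binomial K u, binomial K v}) :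
    ¬ ((∃ i, u i = 1 ∧ v i = 1) ∧ ∃ j, u j = -1 ∧ v j = -1) := by
  rintro ⟨⟨i, hui, hvi⟩, j, huj, hvj⟩
  have hb : ∀ x : Fin n → ℤ, x i = 1 → x j = -1 →
      binomial K x ∈ Ideal.span (MvPolynomial.X '' {i, j} : Set (MvPolynomial (Fin n) K)) := by
    intro x hi hj
    rw [MvPolynomial.mem_ideal_span_X_image]
    intro e he
    rcases eq_or_eq_of_mem_support he with rfl | rfl
    · exact ⟨i, by simp, by simp [posExp_apply, hi]⟩
    · exact ⟨j, by simp, by simp [negExp_apply, hj]⟩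
  have hle : Ideal.span {binomial K u, binomial K v} ≤
      Ideal.span (MvPolynomial.X '' {i, j} : Set (MvPolynomial (Fin n) K)) := by
    rw [Ideal.span_le]
    rintro _ (rfl | rfl)
    exacts [hb u hui huj, hb v hvi hvj]
  -- `u - v` vanishes at `i` and `j`, so its positive monomial involves neither variable.
  obtain ⟨k, hk, hk0⟩ := MvPolynomial.mem_ideal_span_X_image.1 (hle h) _
    (posExp_mem_support (sub_ne_zero.2 huv))
  rcases hk with rfl | rfl <;> simp_all [posExp_apply]

/-- Each hypothesis excludes one of two sign overlaps. In every combination the two excluded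
overlaps involve a common monomial, which is thus disjoint from the other vector. -/
theorem exists_disjoint_support {u v : Fin n → ℤ}
    (hu : ∀ i, u i = -1 ∨ u i = 0 ∨ u i = 1) (hv : ∀ i, v i = -1 ∨ v i = 0 ∨ v i = 1)
    (h : ¬ ((∃ i, u i = 1 ∧ v i = 1) ∧ ∃ j, u j = -1 ∧ v j = -1))
    (h' : ¬ ((∃ i, u i = 1 ∧ v i = -1) ∧ ∃ j, u j = -1 ∧ v j = 1)) :
    (∀ i, u i = 1 → v i = 0) ∨ (∀ i, u i = -1 → v i = 0) ∨
      (∀ i, v i = 1 → u i = 0) ∨ ∀ i, v i = -1 → u i = 0 := by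
  rw [not_and_or] at h h'
  rcases h with h | h <;> rcases h' with h' | h'
  · refine Or.inl fun i hi => ?_
    rcases hv i with hvi | hvi | hvi
    exacts [(h' ⟨i, hi, hvi⟩).elim, hvi, (h ⟨i, hi, hvi⟩).elim]
  · refine Or.inr (Or.inr (Or.inl fun i hi => ?_))
    rcases hu i with hui | hui | hui
    exacts [(h' ⟨i, hui, hi⟩).elim, hui, (h ⟨i, hui, hi⟩).elim]
  · refine Or.inr (Or.inr (Or.inr fun i hi => ?_))
    rcases hu i with hui | hui | hui
    exacts [(h ⟨i, hui, hi⟩).elim, hui, (h' ⟨i, hui, hi⟩).elim]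
  · refine Or.inr (Or.inl fun i hi => ?_)
    rcases hv i with hvi | hvi | hvi
    exacts [(h ⟨i, hi, hvi⟩).elim, hvi, (h' ⟨i, hi, hvi⟩).elim]

/-! ### Gröbner bases from coprime initial monomials. -/

theorem isGroebnerBasis_of_degree_le (m : MonomialOrder (Fin n))
    {I : Ideal (MvPolynomial (Fin n) K)} {G : Set (MvPolynomial (Fin n) K)} (hfin : G.Finite)
    (h0 : 0 ∉ G) (hGI : G ⊆ I) (h : ∀ g ∈ I, g ≠ 0 → ∃ f ∈ G, m.degree f ≤ m.degree g) :
    IsGroebnerBasis m I G := by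
  refine ⟨hfin, h0, hGI, le_antisymm ?_ ?_⟩
  · exact Ideal.span_mono (Set.image_mono fun f hf => ⟨hGI hf.1, hf.2⟩)
  · rw [initialIdeal, Ideal.span_le]
    rintro _ ⟨g, ⟨hg, hg0⟩, rfl⟩
    obtain ⟨f, hf, hle⟩ := h g hg hg0
    have : mon K (m.degree g) = mon K (m.degree g - m.degree f) * mon K (m.degree f) := by
      simp [mon, MvPolynomial.monomial_mul, tsub_add_cancel_of_le hle]
    simp only [SetLike.mem_coe]
    rw [this]
    exact Ideal.mul_mem_left _ _
      (Ideal.subset_span ⟨f, ⟨hf, fun hf0 => h0 (hf0 ▸ hf)⟩, rfl⟩)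

/-- Two polynomials with coprime initial monomials form a Gröbner basis. -/
theorem isGroebnerBasis_pair_of_disjoint_degree (m : MonomialOrder (Fin n))
    {f₁ f₂ : MvPolynomial (Fin n) K} (h₁ : f₁ ≠ 0) (h₂ : f₂ ≠ 0)
    (hdis : ∀ i, m.degree f₁ i = 0 ∨ m.degree f₂ i = 0) :
    IsGroebnerBasis m (Ideal.span {f₁, f₂}) {f₁, f₂} := by
  refine isGroebnerBasis_of_degree_le m (Set.toFinite _) (by simp [h₁.symm, h₂.symm])
    Ideal.subset_span fun g hg hg0 => ?_
  obtain ⟨a, b, rfl⟩ := Ideal.mem_span_pair.1 hg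
  -- Reducing the coefficient of `f₁` modulo `f₂` prevents cancellation: equal degrees and
  -- coprimality would make the initial monomial of `f₂` divide that of `r`.
  obtain ⟨q, r, rfl, -, hr⟩ := m.div_single (b := f₂)
    (m.leadingCoeff_ne_zero_iff.2 h₂).isUnit a
  have hg' : (q * f₂ + r) * f₁ + b * f₂ = r * f₁ + (q * f₁ + b) * f₂ := by ring
  rw [hg'] at hg0 ⊢
  generalize q * f₁ + b = b' at hg0 ⊢
  by_cases hr0 : r = 0
  · subst hr0
    have hb : b' ≠ 0 := by rintro rfl; simp at hg0
    refine ⟨f₂, by simp, ?_⟩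
    rw [zero_mul, zero_add, m.degree_mul hb h₂]
    exact le_add_self
  by_cases hb : b' = 0
  · refine ⟨f₁, by simp, ?_⟩
    rw [hb, zero_mul, add_zero, m.degree_mul hr0 h₁]
    exact le_add_self
  have hne : m.degree (r * f₁) ≠ m.degree (b' * f₂) := by
    rw [m.degree_mul hr0 h₁, m.degree_mul hb h₂]
    intro h
    refine hr _ (m.degree_mem_support hr0) fun i => ?_
    have hi := DFunLike.congr_fun h i
    simp only [Finsupp.add_apply] at hi
    rcases hdis i with h0 | h0 <;> omega
  have hadd := m.degree_add_of_ne hne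
  rcases le_total (m.toSyn (m.degree (r * f₁))) (m.toSyn (m.degree (b' * f₂))) with hle | hle
  · rw [sup_of_le_right hle, m.toSyn.injective.eq_iff, m.degree_mul hb h₂] at hadd
    exact ⟨f₂, by simp, hadd ▸ le_add_self⟩
  · rw [sup_of_le_left hle, m.toSyn.injective.eq_iff, m.degree_mul hr0 h₁] at hadd
    exact ⟨f₁, by simp, hadd ▸ le_add_self⟩

theorem isGroebnerBasis_pair_of_dvd (m : MonomialOrder (Fin n))
    {f₁ f₂ : MvPolynomial (Fin n) K} (h₁ : f₁ ≠ 0) (h₂ : f₂ ≠ 0) (hdvd : f₁ ∣ f₂) :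
    IsGroebnerBasis m (Ideal.span {f₁, f₂}) {f₁, f₂} := by
  refine isGroebnerBasis_of_degree_le m (Set.toFinite _) (by simp [h₁.symm, h₂.symm])
    Ideal.subset_span fun g hg hg0 => ⟨f₁, by simp, ?_⟩
  obtain ⟨a, b, rfl⟩ := Ideal.mem_span_pair.1 hg
  obtain ⟨c, hc⟩ : f₁ ∣ a * f₁ + b * f₂ :=
    dvd_add (dvd_mul_left _ _) (dvd_mul_of_dvd_right hdvd _)
  rw [hc] at hg0 ⊢
  rw [m.degree_mul h₁ (right_ne_zero_of_mul hg0)]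
  exact le_self_add

/-- A lexicographic order whose largest variable is `x_i`. -/
theorem exists_monomialOrder_lt (i : Fin n) : ∃ m : MonomialOrder.{0, 0} (Fin n),
    ∀ e e' : Fin n →₀ ℕ, e i < e' i → m.toSyn e < m.toSyn e' := by
  have : NeZero n := ⟨by have := i.2; omega⟩
  -- The swap puts `i` first in the index order, and lex compares the first index first.
  let s : Fin n ≃ Fin n := Equiv.swap 0 i
  let o : LinearOrder (Fin n) := LinearOrder.lift' s s.injective
  refine ⟨@MonomialOrder.lex _ o (@Finite.to_wellFoundedGT _ _ o.toPreorder), fun e e' h => ?_⟩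
  refine ⟨i, fun j hj => ?_, h⟩
  have : s j < s i := hj
  simp [s] at this

theorem exists_disjoint_degree {u v : Fin n → ℤ} (hu : ∃ i, u i = 1)
    (hu' : ∀ i, u i = -1 ∨ u i = 0 ∨ u i = 1) (huv : ∀ i, u i = 1 → v i = 0) (hv0 : v ≠ 0) :
    ∃ m : MonomialOrder.{0, 0} (Fin n),
      ∀ i, m.degree (binomial K u) i = 0 ∨ m.degree (binomial K v) i = 0 := by
  obtain ⟨i₀, hi₀⟩ := hu
  have hu0 : u ≠ 0 := by rintro rfl; simp at hi₀
  obtain ⟨m, hm⟩ := exists_monomialOrder_lt i₀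
  have hdu : m.degree (binomial K u) = posExp u := by
    refine (eq_or_eq_of_mem_support (m.degree_mem_support (binomial_ne_zero hu0))).resolve_right
      fun h => ?_
    refine (m.le_degree (posExp_mem_support (K := K) hu0)).not_gt (hm _ _ ?_)
    simp [h, posExp_apply, negExp_apply, hi₀]
  refine ⟨m, fun i => ?_⟩
  rw [hdu, posExp_apply]
  rcases hu' i with h | h | h
  · simp [h]
  · simp [h]
  · right
    rcases eq_or_eq_of_mem_support (m.degree_mem_support (binomial_ne_zero (K := K) hv0)) with
      hd | hd <;> rw [hd] <;> simp [posExp_apply, negExp_apply, huv i h]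

/-- The hyperplane makes `I_A` homogeneous; hence a nonzero `u` has a positive entry to head the lex
order. -/
theorem sum_eq_zero_of_isConfiguration {A : Matrix (Fin d) (Fin n) ℤ} (hA : IsConfiguration A)
    {u : Fin n → ℤ} (hu : A.mulVec u = 0) : ∑ j, u j = 0 := by
  obtain ⟨w, c, -, hc, h⟩ := hA
  have h1 : ∑ j, c * (u j : ℝ) = 0 := by
    have h2 : ∀ i, ∑ j, (A i j : ℝ) * (u j : ℝ) = 0 := fun i => by
      have := congrFun hu i
      simp only [Matrix.mulVec, dotProduct, Pi.zero_apply] at this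
      exact_mod_cast this
    calc ∑ j, c * (u j : ℝ) = ∑ j, ∑ i, w i * ((A i j : ℝ) * (u j : ℝ)) := by
          refine Finset.sum_congr rfl fun j _ => ?_
          rw [← h j, Finset.sum_mul]
          exact Finset.sum_congr rfl fun i _ => mul_assoc _ _ _
      _ = 0 := by
          rw [Finset.sum_comm]
          refine Finset.sum_eq_zero fun i _ => ?_
          rw [← Finset.mul_sum, h2, mul_zero]
  rw [← Finset.mul_sum] at h1
  exact_mod_cast (mul_eq_zero.1 h1).resolve_left hc

theorem exists_eq_one {u : Fin n → ℤ} (hu : ∀ i, u i = -1 ∨ u i = 0 ∨ u i = 1)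
    (hsum : ∑ j, u j = 0) (hu0 : u ≠ 0) : ∃ i, u i = 1 := by
  by_contra! h
  have hle : ∀ i ∈ Finset.univ, u i ≤ 0 := fun i _ => by
    rcases hu i with h' | h' | h'
    exacts [by omega, by omega, (h i h').elim]
  exact hu0 (funext fun i => (Finset.sum_eq_zero_iff_of_nonpos hle).1 hsum i (Finset.mem_univ i))

theorem disjoint_degree_and_isIntegrallyClosed {A : Matrix (Fin d) (Fin n) ℤ}
    (hA : IsConfiguration A) {u v : Fin n → ℤ} (hu0 : u ≠ 0) (hv0 : v ≠ 0)
    (hu : ∀ i, u i = -1 ∨ u i = 0 ∨ u i = 1) (hv : ∀ i, v i = -1 ∨ v i = 0 ∨ v i = 1)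
    (huv : ∀ i, u i = 1 → v i = 0) (hAu : A.mulVec u = 0) (hAv : A.mulVec v = 0)
    (hker : ∀ w, A.mulVec w = 0 → ∃ k m : ℤ, w = k • u + m • v) :
    (∃ m : MonomialOrder.{0, 0} (Fin n),
      ∀ i, m.degree (binomial K u) i = 0 ∨ m.degree (binomial K v) i = 0) ∧
    IsIntegrallyClosed (toricRing K A) :=
  ⟨exists_disjoint_degree (exists_eq_one hu (sum_eq_zero_of_isConfiguration hA hAu) hu0) hu huv
    hv0, isIntegrallyClosed_toricRing hu hv huv hAu hAv hker⟩

theorem neg_apply_cases {u : Fin n → ℤ} (hu : ∀ i, u i = -1 ∨ u i = 0 ∨ u i = 1) (i : Fin n) :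
    (-u) i = -1 ∨ (-u) i = 0 ∨ (-u) i = 1 := by
  have := hu i
  simp only [Pi.neg_apply]; omega

end ToricIdeal

/-! ### The theorem. -/

open ToricIdeal in
theorem proposition2p9 {K : Type*} [Field K] {d n : ℕ} (A : Matrix (Fin d) (Fin n) ℤ)
    (hA : ToricIdeal.IsConfiguration A)
    (hcol : Function.Injective fun (j : Fin n) (i : Fin d) => A i j)
    (u v : Fin n → ℤ) (hu : u ≠ 0) (hv : v ≠ 0)
    (hgen : ToricIdeal.toricIdeal K A =
      Ideal.span {ToricIdeal.binomial K u, ToricIdeal.binomial K v})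
    (hu_pos : Squarefree (ToricIdeal.mon K (ToricIdeal.posExp u)))
    (hu_neg : Squarefree (ToricIdeal.mon K (ToricIdeal.negExp u)))
    (hv_pos : Squarefree (ToricIdeal.mon K (ToricIdeal.posExp v)))
    (hv_neg : Squarefree (ToricIdeal.mon K (ToricIdeal.negExp v))) :
    (∃ m : MonomialOrder.{0, 0} (Fin n),
      ToricIdeal.IsGroebnerBasis m (ToricIdeal.toricIdeal K A)
        {ToricIdeal.binomial K u, ToricIdeal.binomial K v}) ∧
    IsIntegrallyClosed (ToricIdeal.toricRing K A) := by
  have hu' := eq_of_squarefree hu_pos hu_neg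
  have hv' := eq_of_squarefree hv_pos hv_neg
  have hAu : A.mulVec u = 0 := binomial_mem_toricIdeal.1 (hgen ▸ Ideal.subset_span (by simp))
  have hAv : A.mulVec v = 0 := binomial_mem_toricIdeal.1 (hgen ▸ Ideal.subset_span (by simp))
  have hker : ∀ w, A.mulVec w = 0 → ∃ k m : ℤ, w = k • u + m • v := fun w hw =>
    exists_zsmul_add_zsmul (hgen ▸ binomial_mem_toricIdeal.2 hw)
  -- Here the ideal is principal, and the normality argument runs with `0` in place of `v`.
  by_cases heq : v = u ∨ v = -u
  · refine ⟨⟨MonomialOrder.lex, hgen ▸ isGroebnerBasis_pair_of_dvd _ (binomial_ne_zero hu)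
      (binomial_ne_zero hv) ?_⟩, isIntegrallyClosed_toricRing (v := 0) hu' (by simp) (by simp) hAu
      (Matrix.mulVec_zero A) fun w hw => ?_⟩
    · rcases heq with rfl | rfl
      · exact dvd_rfl
      · rw [binomial_neg]; exact (dvd_neg).2 dvd_rfl
    · obtain ⟨k, m, rfl⟩ := hker w hw
      rcases heq with rfl | rfl
      · exact ⟨k + m, 0, by module⟩
      · exact ⟨k - m, 0, by module⟩
  push Not at heq
  have h1 := not_mixed (K := K) heq.1.symm (hgen ▸ binomial_mem_toricIdeal.2
    (by rw [Matrix.mulVec_sub, hAu, hAv, sub_zero]))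
  have h2 := not_mixed (K := K) (u := u) (v := -v) (fun h => heq.2 (by rw [h, neg_neg])) (by
    have : Ideal.span {binomial K u, binomial K (-v)} = toricIdeal K A := by
      rw [hgen, binomial_neg, Ideal.span_insert, Ideal.span_insert, Ideal.span_singleton_neg]
    rw [this, binomial_mem_toricIdeal, Matrix.mulVec_sub, Matrix.mulVec_neg, hAu, hAv, neg_zero,
      sub_zero])
  have hker' : ∀ w, A.mulVec w = 0 → ∃ k m : ℤ, w = k • v + m • u := fun w hw => by
    obtain ⟨k, m, rfl⟩ := hker w hw
    exact ⟨m, k, add_comm _ _⟩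
  suffices h : (∃ m : MonomialOrder.{0, 0} (Fin n),
      ∀ i, m.degree (binomial K u) i = 0 ∨ m.degree (binomial K v) i = 0) ∧
      IsIntegrallyClosed (toricRing K A) by
    obtain ⟨⟨m, hm⟩, h⟩ := h
    exact ⟨⟨m, hgen ▸ isGroebnerBasis_pair_of_disjoint_degree m (binomial_ne_zero hu)
      (binomial_ne_zero hv) hm⟩, h⟩
  have hneg : ∀ x : Fin n → ℤ, A.mulVec x = 0 → A.mulVec (-x) = 0 := fun x hx => by
    rw [Matrix.mulVec_neg, hx, neg_zero]
  -- Negating a vector only changes the sign of its binomial, so negation and swapping reduce all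
  -- cases to the first.
  rcases exists_disjoint_support hu' hv' h1 (by simpa [neg_eq_iff_eq_neg] using h2) with
    h | h | h | h
  · exact disjoint_degree_and_isIntegrallyClosed hA hu hv hu' hv' h hAu hAv hker
  · have := disjoint_degree_and_isIntegrallyClosed (K := K) hA (neg_ne_zero.2 hu) hv
      (neg_apply_cases hu') hv' (fun i hi => h i (by simp at hi; omega)) (hneg u hAu) hAv
      fun w hw => by
        obtain ⟨k, m, rfl⟩ := hker w hw
        exact ⟨-k, m, by module⟩
    simpa only [binomial_neg, MonomialOrder.degree_neg] using this
  · have := disjoint_degree_and_isIntegrallyClosed (K := K) hA hv hu hv' hu' h hAv hAu hker'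
    simpa only [or_comm] using this
  · have := disjoint_degree_and_isIntegrallyClosed (K := K) hA (neg_ne_zero.2 hv) hu
      (neg_apply_cases hv') hu' (fun i hi => h i (by simp at hi; omega)) (hneg v hAv) hAu
      fun w hw => by
        obtain ⟨k, m, rfl⟩ := hker' w hw
        exact ⟨-k, m, by module⟩
    simpa only [binomial_neg, MonomialOrder.degree_neg, or_comm] using this
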